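/- Consider $N$ persons $1,\dots,N$ and two strongly connected directed networks $G_R=(V,E_R)$, $G_T=(V,E_T)$ on $V=\{1,\dots,N\}$. Let $B_U=(\beta^U_{ij})$ and $C_U=(\gamma^U_{ij})$ be nonnegative matrices with $\beta^U_{ij}>0$ iff $(i,j)\in E_R$ and $\gamma^U_{ij}>0$ iff $(i,j)\in E_T$, and let $D_R=\mathrm{diag}(\delta^R_i)$, $D_T=\mathrm{diag}(\delta^T_i)$ with $\delta^R_i,\delta^T_i>0$. The generic URTU model is the system $$\begin{aligned}\dot R_i&=(1-R_i-T_i)f^U_i(R)-\delta^R_iR_i+T_if^T_i(R)-R_ig^R_i(T),\\ \dot T_i&=(1-R_i-T_i)g^U_i(T)-\delta^T_iT_i+R_ig^R_i(T)-T_if^T_i(R),\end{aligned}\qquad 1\le i\le N,$$ where the spreading rates $f^U_i,f^T_i,g^U_i,g^R_i$ are real functions that are twice continuously differentiable around every point of $[0,1]^N$ and satisfy on $[0,1]^N$: $f^U_i,f^T_i$ (respectively $g^U_i,g^R_i$) depend on $x_j$ iff $(i,j)\in E_R$ (respectively $(i,j)\in E_T$); they vanish at $0$; $f^U_i\ge f^T_i$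 and $g^U_i\ge g^R_i$; each of them has a positive partial derivative in every $x_j$ on which it depends; and all their second-order partial derivatives are $\le 0$. Put $\Omega=\{(R,T)\in\mathbb R_{\ge0}^{2N}: R_i+T_i\le1 \text{ for all } i\}$, $E_U=(0,0)$, $Q_1=\frac{\partial f_U}{\partial x}(0)-D_R$, $Q_2=\frac{\partial g_U}{\partial x}(0)-D_T$ (with the Jacobian matrices at the origin of $f_U=(f^U_1,\dots,f^U_N)$ and $g_U=(g^U_1,\dots,g^U_N)$), and let $\rho$ be the spectral radius and $E_N$ the identity matrix. Say that $E_U$ attracts $\Omega$ if every solution on $[0,\infty)$ with initial state in $\Omega$ converges to $E_U$ as $t\to\infty$. Then $E_U$ attracts $\Omega$ if (a) $\rho(Q_1D_R^{-1}+E_N)<1$ and $\rho(Q_2D_T^{-1}+E_N)<1$. If moreover $\beta^U_{ij}$ and $\gamma^U_{ij}$ are the pairwise rates of the model, in the sense that $f^U_i(x)\le\sum_j\beta^U_{ij}x_j$ and $g^U_i(x)\le\sum_j\gamma^U_{ij}x_j$ for all $i$ and all $x\in[0,1]^N$, then each of the following conditions also implies that $E_U$ attracts $\Omega$: (b) $\rho(B_UD_R^{-1})<1$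 and $\rho(C_UD_T^{-1})<1$; (c) $\sum_{i}\beta^U_{ij}<\delta^R_j$ and $\sum_{i}\gamma^U_{ij}<\delta^T_j$ for every $j$; (d) $\sum_{j}\beta^U_{ij}/\delta^R_j<1$ and $\sum_{j}\gamma^U_{ij}/\delta^T_j<1$ for every $i$. -/

import Mathlib

open Set Filter Topology

/-- The unit cube `[0,1]^N`, in which the arguments of the spreading rates live. -/
def unitCube (N : ℕ) : Set (Fin N → ℝ) := {x | ∀ i, 0 ≤ x i ∧ x i ≤ 1}

/-- The partial derivative `∂f/∂x_j` at the point `x`. -/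
noncomputable def partialDeriv {N : ℕ} (f : (Fin N → ℝ) → ℝ) (j : Fin N) (x : Fin N → ℝ) : ℝ :=
  fderiv ℝ f x (Pi.single j 1)

/-- On the unit cube, the function `f` depends on its `j`-th argument. -/
def DependsOnArg {N : ℕ} (f : (Fin N → ℝ) → ℝ) (j : Fin N) : Prop :=
  ∃ x ∈ unitCube N, ∃ y ∈ unitCube N, (∀ k, k ≠ j → x k = y k) ∧ f x ≠ f y

/-- The digraph with edge relation `E` is strongly connected. -/
def StronglyConnected {N : ℕ} (E : Fin N → Fin N → Prop) : Prop :=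
  ∀ i j, Relation.ReflTransGen E i j

/-- The conditions that concern a single family `f_1, …, f_N` of spreading rates over a network
with edge relation `E`: proximity, nullity, smoothness (twice continuously differentiable around
every point of the unit cube), monotonicity and concavity. -/
structure IsSpreadingRate {N : ℕ} (E : Fin N → Fin N → Prop)
    (f : Fin N → (Fin N → ℝ) → ℝ) : Prop where
  proximity : ∀ i j, DependsOnArg (f i) j ↔ E i j
  nullity : ∀ i, f i 0 = 0
  smooth : ∀ i, ∀ x ∈ unitCube N, ContDiffAt ℝ 2 (f i) x
  mono : ∀ i j, DependsOnArg (f i) j → ∀ x ∈ unitCube N, 0 < partialDeriv (f i) j x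
  concave : ∀ i j k, ∀ x ∈ unitCube N, partialDeriv (partialDeriv (f i) k) j x ≤ 0

/-- The generic URTU (Uncertain-Rumor-Truth-Uncertain) model on `N` persons. -/
structure URTUModel (N : ℕ) where
  /-- rumor-spreading network: `ER i j` iff person `j` can tell the rumor to person `i` -/
  ER : Fin N → Fin N → Prop
  /-- truth-spreading network: `ET i j` iff person `j` can tell the truth to person `i` -/
  ET : Fin N → Fin N → Prop
  /-- the matrix `B_U` of the rates `β_ij^U` -/
  BU : Matrix (Fin N) (Fin N) ℝ
  /-- the matrix `C_U` of the rates `γ_ij^U` -/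
  CU : Matrix (Fin N) (Fin N) ℝ
  /-- the recovery rates `δ_i^R` -/
  deltaR : Fin N → ℝ
  /-- the recovery rates `δ_i^T` -/
  deltaT : Fin N → ℝ
  /-- rumor-spreading rates `f_i^U` towards uncertain persons -/
  fU : Fin N → (Fin N → ℝ) → ℝ
  /-- rumor-spreading rates `f_i^T` towards truth-believers -/
  fT : Fin N → (Fin N → ℝ) → ℝ
  /-- truth-spreading rates `g_i^U` towards uncertain persons -/
  gU : Fin N → (Fin N → ℝ) → ℝ
  /-- truth-spreading rates `g_i^R` towards rumor-believers -/
  gR : Fin N → (Fin N → ℝ) → ℝ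
  ER_conn : StronglyConnected ER
  ET_conn : StronglyConnected ET
  BU_nonneg : ∀ i j, 0 ≤ BU i j
  BU_pos_iff : ∀ i j, 0 < BU i j ↔ ER i j
  CU_nonneg : ∀ i j, 0 ≤ CU i j
  CU_pos_iff : ∀ i j, 0 < CU i j ↔ ET i j
  deltaR_pos : ∀ i, 0 < deltaR i
  deltaT_pos : ∀ i, 0 < deltaT i
  fU_rate : IsSpreadingRate ER fU
  fT_rate : IsSpreadingRate ER fT
  gU_rate : IsSpreadingRate ET gU
  gR_rate : IsSpreadingRate ET gR
  ordering_f : ∀ i, ∀ x ∈ unitCube N, fT i x ≤ fU i x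
  ordering_g : ∀ i, ∀ x ∈ unitCube N, gR i x ≤ gU i x

namespace URTUModel

variable {N : ℕ}

/-- `β_ij^U` and `γ_ij^U` are the pairwise rates behind `f_i^U` and `g_i^U`: an uncertain person `i`
is converted at most at the total rate `∑_j β_ij^U x_j` (resp. `∑_j γ_ij^U x_j`) that its individual
neighbours `j` contribute, the linear rate that `f_i^U` (resp. `g_i^U`) flattens out from. -/
def PairwiseRates (M : URTUModel N) : Prop :=
  (∀ i, ∀ x ∈ unitCube N, M.fU i x ≤ ∑ j, M.BU i j * x j) ∧
  (∀ i, ∀ x ∈ unitCube N, M.gU i x ≤ ∑ j, M.CU i j * x j)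

/-- `D_R = diag(δ_i^R)`. -/
noncomputable def DR (M : URTUModel N) : Matrix (Fin N) (Fin N) ℝ := Matrix.diagonal M.deltaR

/-- `D_T = diag(δ_i^T)`. -/
noncomputable def DT (M : URTUModel N) : Matrix (Fin N) (Fin N) ℝ := Matrix.diagonal M.deltaT

/-- `Q₁ = ∂f_U(0)/∂x - D_R`. -/
noncomputable def Q1 (M : URTUModel N) : Matrix (Fin N) (Fin N) ℝ :=
  (Matrix.of fun i j => partialDeriv (M.fU i) j 0) - M.DR

/-- `Q₂ = ∂g_U(0)/∂x - D_T`. -/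
noncomputable def Q2 (M : URTUModel N) : Matrix (Fin N) (Fin N) ℝ :=
  (Matrix.of fun i j => partialDeriv (M.gU i) j 0) - M.DT

/-- The trajectory `t ↦ (R(t), T(t))` solves the differential equations of the model for all
`t ≥ 0`. -/
def IsSolution (M : URTUModel N) (z : ℝ → (Fin N → ℝ) × (Fin N → ℝ)) : Prop :=
  ∀ t : ℝ, 0 ≤ t → ∀ i : Fin N,
    HasDerivWithinAt (fun s => (z s).1 i)
      ((1 - (z t).1 i - (z t).2 i) * M.fU i (z t).1 - M.deltaR i * (z t).1 i
        + (z t).2 i * M.fT i (z t).1 - (z t).1 i * M.gR i (z t).2) (Ici 0) t ∧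
    HasDerivWithinAt (fun s => (z s).2 i)
      ((1 - (z t).1 i - (z t).2 i) * M.gU i (z t).2 - M.deltaT i * (z t).2 i
        + (z t).1 i * M.gR i (z t).2 - (z t).2 i * M.fT i (z t).1) (Ici 0) t

/-- The equilibrium `E` of the model attracts the set `S`: every solution that starts in `S`
converges to `E`. -/
def Attracts (M : URTUModel N) (E : (Fin N → ℝ) × (Fin N → ℝ))
    (S : Set ((Fin N → ℝ) × (Fin N → ℝ))) : Prop :=
  ∀ z : ℝ → (Fin N → ℝ) × (Fin N → ℝ), M.IsSolution z → z 0 ∈ S → Tendsto z atTop (𝓝 E)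

end URTUModel

/-- The state space `Ω` of all `(R, T)` with `R_i, T_i ≥ 0` and `R_i + T_i ≤ 1`. -/
def stateSpace (N : ℕ) : Set ((Fin N → ℝ) × (Fin N → ℝ)) :=
  {z | ∀ i, 0 ≤ z.1 i ∧ 0 ≤ z.2 i ∧ z.1 i + z.2 i ≤ 1}

/-- The uncertain equilibrium `E_U = (0, 0)`. -/
def uncertainEquilibrium (N : ℕ) : (Fin N → ℝ) × (Fin N → ℝ) := (0, 0)

/-- The spectral radius of a real square matrix: the largest modulus of a complex eigenvalue. -/
noncomputable def matrixSpectralRadius {N : ℕ} (A : Matrix (Fin N) (Fin N) ℝ) : ENNReal :=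
  spectralRadius ℂ (A.map (algebraMap ℝ ℂ))

/-! On `Ω` the two rumours decouple into linear inequalities. Since `f_T ≤ f_U` and the loss to
truth is nonnegative, `R' ≤ (1 - R) f_U(R) - D_R R ≤ A R - D_R R` for any matrix `A` whose linear
map dominates `f_U`; the same holds for `T`. By concavity the Jacobian at `0` is such an `A`, which
serves (a); `B_U` and `C_U` serve the other conditions. A positive row vector `w` with `w A < w D`
makes `w · x` a linear Lyapunov function that decays exponentially (`tendsto_zero_of_weights`).

If a nonnegative matrix `P` has `ρ(P) < 1`, some power `P^n` has all column sums below 1, and the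
column sums of `1 + P + ⋯ + P^(n-1)` are weights with `w P < w`
(`exists_weights_of_spectralRadius_lt_one`). Condition (c) says that `w = 1` works; (d) implies (b),
because the row-sum norm bounds `ρ`.

The delicate point is invariance of `Ω`: the sign conditions hold only on the cube, which a solution
might leave. Smoothness around the cube gives errors of order `η` at distance `η`, and an
exponential barrier absorbs them (`nonneg_of_quasipositive`). -/

/-! ### Differential inequalities: barriers and linear Lyapunov functions. -/

theorem HasDerivWithinAt.eventually_lt_of_pos {f : ℝ → ℝ} {f' t : ℝ}
    (hf : HasDerivWithinAt f f' (Ioi t) t) (h : 0 < f') : ∀ᶠ s in 𝓝[>] t, f t < f s := by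
  have h1 := (hasDerivWithinAt_iff_tendsto_slope' (by simp)).1 hf
  filter_upwards [h1.eventually (lt_mem_nhds h), self_mem_nhdsWithin] with s hs hts
  exact (slope_pos_iff_of_le (le_of_lt hts)).1 hs

/-- A finite family of functions that is initially nonnegative stays nonnegative if, whenever the
lowest of them is at a slightly negative level `-η`, its derivative is at least `-C * η`. -/
theorem nonneg_of_quasipositive {ι : Type*} [Finite ι] {u u' : ι → ℝ → ℝ}
    (hd : ∀ a t, 0 ≤ t → HasDerivWithinAt (u a) (u' a t) (Ici 0) t) (h0 : ∀ a, 0 ≤ u a 0)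
    (hq : ∀ a, ∃ C, ∀ᶠ η in 𝓝[>] (0 : ℝ), ∀ t, 0 ≤ t → (∀ b, -η ≤ u b t) → u a t = -η →
      -C * η ≤ u' a t) :
    ∀ t, 0 ≤ t → ∀ a, 0 ≤ u a t := by
  intro T hT
  choose C hC using hq
  -- Strictness of `C a < K` makes a function touching the barrier `-ε * exp (K * t)` leave it
  -- upwards.
  obtain ⟨K, hK⟩ : ∃ K, ∀ a, C a < K := by
    obtain ⟨K, hK⟩ := Finite.bddAbove_range C
    exact ⟨K + 1, fun a => (hK ⟨a, rfl⟩).trans_lt (lt_add_one K)⟩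
  obtain ⟨η₀, hη₀, hη⟩ := mem_nhdsGT_iff_exists_Ioc_subset.1 (eventually_all.2 hC)
  have hη₀ : 0 < η₀ := hη₀
  -- The bound with `|K|` keeps the barrier's level within `(0, η₀]` on all of `[0, T]`, whatever
  -- the sign of `K`.
  have key : ∀ ε > 0, ε * Real.exp (|K| * T) ≤ η₀ → ∀ a, -(ε * Real.exp (K * T)) ≤ u a T := by
    intro ε hε hεT
    set s : Set ℝ := {t | (fun _ : ι => -(ε * Real.exp (K * t))) ≤ fun a => u a t} with hs
    have hcont : ContinuousOn (fun t a => u a t) (Icc 0 T) := by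
      refine continuousOn_pi.2 fun a t ht => ?_
      exact (hd a t ht.1).continuousWithinAt.mono fun x hx => hx.1
    have hcl : IsClosed (s ∩ Icc 0 T) := by
      have := isClosed_Icc.isClosed_le (s := Icc 0 T)
        (f := fun t => fun _ : ι => -(ε * Real.exp (K * t))) (g := fun t a => u a t)
        (by fun_prop) hcont
      convert this using 1
      ext t
      simp [hs, and_comm]
    -- Continuous induction along `[0, T]`: continuity handles functions above the barrier, a
    -- positive derivative those touching it.
    have hsub : Icc 0 T ⊆ s := by
      refine hcl.Icc_subset_of_forall_exists_gt ?_ ?_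
      · intro a
        have := h0 a
        simp only [mul_zero, Real.exp_zero, mul_one]
        linarith
      · rintro t ⟨hts, ht⟩ y hy
        have hall : ∀ᶠ r in 𝓝[>] t, ∀ a, -(ε * Real.exp (K * r)) ≤ u a r := by
          refine eventually_all.2 fun a => ?_
          have hda : HasDerivWithinAt (fun r => u a r + ε * Real.exp (K * r))
              (u' a t + ε * (Real.exp (K * t) * K)) (Ioi t) t := by
            refine HasDerivWithinAt.add ((hd a t ht.1).mono fun x hx => ht.1.trans hx.le) ?_
            have : HasDerivAt (fun r => K * r) K t := by simpa using (hasDerivAt_id t).const_mul K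
            exact (this.exp.const_mul ε).hasDerivWithinAt
          have hpos : 0 ≤ u a t + ε * Real.exp (K * t) := by
            have := hts a
            simp only at this
            linarith
          rcases hpos.lt_or_eq with h | h
          · filter_upwards [hda.continuousWithinAt.eventually (lt_mem_nhds h)] with r hr
            linarith
          · have hE : 0 < ε * Real.exp (K * t) := by positivity
            have hle : ε * Real.exp (K * t) ≤ η₀ := by
              refine le_trans (mul_le_mul_of_nonneg_left (Real.exp_le_exp.2 ?_) hε.le) hεT
              exact mul_le_mul (le_abs_self K) ht.2.le ht.1 (abs_nonneg K)
            have hder := hη ⟨hE, hle⟩ a t ht.1 hts (by linarith)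
            have : 0 < u' a t + ε * (Real.exp (K * t) * K) := by
              have := mul_lt_mul_of_pos_right (hK a) hE
              linarith
            filter_upwards [hda.eventually_lt_of_pos this] with r hr
            linarith
        obtain ⟨r, hr, hr'⟩ := (hall.and (Ioc_mem_nhdsGT hy)).exists
        exact ⟨r, hr, hr'⟩
    exact hsub (right_mem_Icc.2 hT)
  intro a
  have hlim : Tendsto (fun ε : ℝ => -(ε * Real.exp (K * T))) (𝓝[>] 0) (𝓝 0) := by
    have : Continuous fun ε : ℝ => -(ε * Real.exp (K * T)) := by fun_prop
    simpa using (this.tendsto 0).mono_left nhdsWithin_le_nhds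
  refine le_of_tendsto hlim ?_
  have hlim' : Tendsto (fun ε : ℝ => ε * Real.exp (|K| * T)) (𝓝[>] 0) (𝓝 0) := by
    have : Continuous fun ε : ℝ => ε * Real.exp (|K| * T) := by fun_prop
    simpa using (this.tendsto 0).mono_left nhdsWithin_le_nhds
  filter_upwards [hlim'.eventually (gt_mem_nhds hη₀), self_mem_nhdsWithin] with ε h1 h2
  exact key ε h2 h1.le a

/-- Nonnegative functions obeying a linear differential inequality `x' ≤ A x - D x` tend to zero if
a positive weight vector `w` satisfies `w A < w D`. -/
theorem tendsto_zero_of_weights {ι : Type*} [Fintype ι] {A : Matrix ι ι ℝ} {d w : ι → ℝ}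
    (hw : ∀ i, 0 < w i) (hwA : ∀ j, ∑ i, w i * A i j < w j * d j) {x x' : ℝ → ι → ℝ}
    (hx : ∀ t, 0 ≤ t → ∀ i, 0 ≤ x t i)
    (hd : ∀ t, 0 ≤ t → ∀ i, HasDerivWithinAt (fun s => x s i) (x' t i) (Ici 0) t)
    (hle : ∀ t, 0 ≤ t → ∀ i, x' t i ≤ ∑ j, A i j * x t j - d i * x t i) :
    Tendsto x atTop (𝓝 0) := by
  -- The finitely many strict inequalities leave a common slack `c`, which becomes the decay rate.
  obtain ⟨c, hc, hcw⟩ : ∃ c > 0, ∀ j, c * w j ≤ w j * d j - ∑ i, w i * A i j := by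
    have : ∀ᶠ c in 𝓝[>] (0 : ℝ), ∀ j, c * w j ≤ w j * d j - ∑ i, w i * A i j := by
      refine eventually_all.2 fun j => ?_
      have h1 : Tendsto (fun c : ℝ => c * w j) (𝓝[>] 0) (𝓝 0) := by
        have : Continuous fun c : ℝ => c * w j := by fun_prop
        simpa using (this.tendsto 0).mono_left nhdsWithin_le_nhds
      exact (h1.eventually (gt_mem_nhds (sub_pos.2 (hwA j)))).mono fun _ h => h.le
    obtain ⟨c, h1, h2⟩ := (this.and self_mem_nhdsWithin).exists
    exact ⟨c, h2, h1⟩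
  set V : ℝ → ℝ := fun t => ∑ i, w i * x t i with hV
  have hVd : ∀ t, 0 ≤ t → HasDerivWithinAt V (∑ i, w i * x' t i) (Ici 0) t := fun t ht =>
    HasDerivWithinAt.fun_sum fun i _ => (hd t ht i).const_mul (w i)
  have hVle : ∀ t, 0 ≤ t → ∑ i, w i * x' t i ≤ -c * V t := by
    intro t ht
    calc ∑ i, w i * x' t i ≤ ∑ i, w i * (∑ j, A i j * x t j - d i * x t i) :=
          Finset.sum_le_sum fun i _ => mul_le_mul_of_nonneg_left (hle t ht i) (hw i).le
      _ = ∑ j, (∑ i, w i * A i j - w j * d j) * x t j := by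
          simp only [mul_sub, sub_mul, Finset.sum_sub_distrib, Finset.mul_sum, Finset.sum_mul]
          rw [Finset.sum_comm]
          simp only [mul_assoc]
      _ ≤ ∑ j, (-(c * w j)) * x t j := Finset.sum_le_sum fun j _ =>
          mul_le_mul_of_nonneg_right (by linarith [hcw j]) (hx t ht j)
      _ = -c * V t := by
          rw [hV, Finset.mul_sum]
          exact Finset.sum_congr rfl fun j _ => by ring
  have hWd : ∀ t, 0 ≤ t → HasDerivWithinAt (fun t => V t * Real.exp (c * t))
      ((∑ i, w i * x' t i) * Real.exp (c * t) + V t * (Real.exp (c * t) * c)) (Ici 0) t := by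
    intro t ht
    have : HasDerivAt (fun r => c * r) c t := by simpa using (hasDerivAt_id t).const_mul c
    exact (hVd t ht).mul this.exp.hasDerivWithinAt
  have hanti : AntitoneOn (fun t => V t * Real.exp (c * t)) (Ici 0) := by
    have hint : ∀ t ∈ interior (Ici (0 : ℝ)), HasDerivAt (fun t => V t * Real.exp (c * t))
        ((∑ i, w i * x' t i) * Real.exp (c * t) + V t * (Real.exp (c * t) * c)) t := by
      intro t ht
      rw [interior_Ici] at ht
      exact (hWd t (le_of_lt ht)).hasDerivAt (Ici_mem_nhds ht)
    refine antitoneOn_of_deriv_nonpos (convex_Ici 0)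
      (fun t ht => (hWd t ht).continuousWithinAt)
      (fun t ht => (hint t ht).differentiableAt.differentiableWithinAt) fun t ht => ?_
    rw [(hint t ht).deriv]
    rw [interior_Ici] at ht
    have h1 := mul_le_mul_of_nonneg_right (hVle t (le_of_lt ht)) (Real.exp_pos (c * t)).le
    linarith
  have hVbound : ∀ t, 0 ≤ t → V t ≤ V 0 * Real.exp (-(c * t)) := by
    intro t ht
    have h1 := hanti (self_mem_Ici) ht ht
    simp only [mul_zero, Real.exp_zero, mul_one] at h1
    rw [Real.exp_neg, ← div_eq_mul_inv, le_div_iff₀ (Real.exp_pos _)]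
    exact h1
  have hexp : Tendsto (fun t : ℝ => V 0 * Real.exp (-(c * t))) atTop (𝓝 0) := by
    have h1 : Tendsto (fun t : ℝ => Real.exp (-(c * t))) atTop (𝓝 0) :=
      Real.tendsto_exp_neg_atTop_nhds_zero.comp (tendsto_id.const_mul_atTop hc)
    simpa using h1.const_mul (V 0)
  refine tendsto_pi_nhds.2 fun i => ?_
  have hi : Tendsto (fun t => w i * x t i) atTop (𝓝 0) := by
    refine tendsto_of_tendsto_of_tendsto_of_le_of_le' tendsto_const_nhds hexp ?_ ?_
    · filter_upwards [eventually_ge_atTop 0] with t ht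
      exact mul_nonneg (hw i).le (hx t ht i)
    · filter_upwards [eventually_ge_atTop 0] with t ht
      refine le_trans ?_ (hVbound t ht)
      exact Finset.single_le_sum (f := fun i => w i * x t i)
        (fun j _ => mul_nonneg (hw j).le (hx t ht j)) (Finset.mem_univ i)
  have := hi.const_mul (w i)⁻¹
  simpa [← mul_assoc, inv_mul_cancel₀ (hw i).ne'] using this

/-! ### Spectral radius below one and positive weights. -/

-- Gelfand's formula gives `‖A ^ n‖ < r ^ n` for large `n` and some `r < 1`, and the row-sum norm
-- dominates every entry.
open scoped Matrix.Norms.Operator in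
theorem exists_pow_entries_lt {N : ℕ} {A : Matrix (Fin N) (Fin N) ℝ}
    (hA : matrixSpectralRadius A < 1) {ε : ℝ} (hε : 0 < ε) :
    ∃ n : ℕ, ∀ i j, |(A ^ n) i j| < ε := by
  set a : Matrix (Fin N) (Fin N) ℂ := A.map (algebraMap ℝ ℂ) with ha
  obtain ⟨r, hr, hr1⟩ := ENNReal.lt_iff_exists_nnreal_btwn.1 hA
  have hr1 : r < 1 := by exact_mod_cast hr1
  have h1 := (spectrum.pow_nnnorm_pow_one_div_tendsto_nhds_spectralRadius a).eventually
    (gt_mem_nhds hr)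
  have h2 : ∀ᶠ n : ℕ in atTop, ((r : ℝ) ^ n) < ε :=
    (tendsto_pow_atTop_nhds_zero_of_lt_one r.2 hr1).eventually (gt_mem_nhds hε)
  obtain ⟨n, hn1, hn2, hn0⟩ := (h1.and (h2.and (eventually_gt_atTop 0))).exists
  refine ⟨n, fun i j => ?_⟩
  have hn : ‖a ^ n‖ < r ^ n := by
    have hn0' : (0 : ℝ) < n := by exact_mod_cast hn0
    have h3 := ENNReal.rpow_lt_rpow hn1 hn0'
    rw [← ENNReal.rpow_mul, one_div, inv_mul_cancel₀ hn0'.ne', ENNReal.rpow_one,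
      ENNReal.rpow_natCast] at h3
    exact_mod_cast h3
  have hent : |(A ^ n) i j| ≤ ‖a ^ n‖ := by
    have h4 : (a ^ n) i j = (((A ^ n) i j : ℝ) : ℂ) := by
      rw [ha, ← RingHom.mapMatrix_apply, ← map_pow]
      simp
    rw [← Real.norm_eq_abs, ← Complex.norm_real, ← h4, Matrix.linfty_opNorm_def]
    have h5 : ‖(a ^ n) i j‖₊ ≤ ∑ k, ‖(a ^ n) i k‖₊ :=
      Finset.single_le_sum (f := fun k => ‖(a ^ n) i k‖₊) (fun _ _ => zero_le)
        (Finset.mem_univ j)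
    have h6 : ∑ k, ‖(a ^ n) i k‖₊ ≤ Finset.univ.sup fun i => ∑ k, ‖(a ^ n) i k‖₊ :=
      Finset.le_sup (f := fun i => ∑ k, ‖(a ^ n) i k‖₊) (Finset.mem_univ i)
    exact_mod_cast h5.trans h6
  exact hent.trans_lt (hn.trans hn2)

theorem Matrix.pow_entries_nonneg {ι : Type*} [Fintype ι] [DecidableEq ι] {A : Matrix ι ι ℝ}
    (hA : ∀ i j, 0 ≤ A i j) (n : ℕ) (i j : ι) : 0 ≤ (A ^ n) i j := by
  induction n generalizing i j with
  | zero => rw [pow_zero, Matrix.one_apply]; split_ifs <;> norm_num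
  | succ n ih =>
    rw [pow_succ, Matrix.mul_apply]
    exact Finset.sum_nonneg fun k _ => mul_nonneg (ih i k) (hA k j)

theorem exists_weights_of_spectralRadius_lt_one {N : ℕ} {A : Matrix (Fin N) (Fin N) ℝ}
    (hA : ∀ i j, 0 ≤ A i j) (hρ : matrixSpectralRadius A < 1) :
    ∃ w : Fin N → ℝ, (∀ i, 0 < w i) ∧ ∀ j, ∑ i, w i * A i j < w j := by
  -- A column has `N` entries, so the bound `1 / (N + 1)` keeps its sum below 1.
  obtain ⟨n, hn⟩ := exists_pow_entries_lt hρ (ε := 1 / (N + 1)) (by positivity)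
  have hcol : ∀ j, ∑ i, (A ^ n) i j < 1 := by
    intro j
    calc ∑ i, (A ^ n) i j ≤ ∑ _i : Fin N, (1 / (N + 1) : ℝ) :=
          Finset.sum_le_sum fun i _ => ((le_abs_self _).trans_lt (hn i j)).le
      _ = N / (N + 1) := by simp [div_eq_mul_inv]
      _ < 1 := by rw [div_lt_one (by positivity)]; linarith
  -- Hence `S` contains the term `A ^ 0 = 1`, which makes the weights positive.
  have hn0 : 0 < N → n ≠ 0 := by
    rintro hN rfl
    have := hcol ⟨0, hN⟩
    simp [Matrix.one_apply] at this
  set S : Matrix (Fin N) (Fin N) ℝ := ∑ k ∈ Finset.range n, A ^ k with hS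
  -- Summing columns: `w A` is `w` plus the column sums of `A ^ n` minus 1, hence below `w`.
  have hSA : S * A = S + A ^ n - 1 := by
    have := geom_sum_mul A n
    rw [mul_sub, mul_one] at this
    rw [hS, sub_eq_iff_eq_add.1 this]
    abel
  refine ⟨fun j => ∑ i, S i j, fun j => ?_, fun j => ?_⟩
  · have h1 : ∀ k i, 0 ≤ (A ^ k) i j := fun k i => Matrix.pow_entries_nonneg hA k i j
    have h0 : (A ^ 0) j j ≤ S j j := by
      rw [hS, Matrix.sum_apply]
      exact Finset.single_le_sum (f := fun k => (A ^ k) j j) (fun k _ => h1 k j)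
        (Finset.mem_range.2 (Nat.pos_of_ne_zero (hn0 j.pos)))
    have h2 : S j j ≤ ∑ i, S i j :=
      Finset.single_le_sum (f := fun i => S i j) (fun i _ => by
        rw [hS, Matrix.sum_apply]
        exact Finset.sum_nonneg fun k _ => h1 k i) (Finset.mem_univ j)
    simp only [pow_zero, Matrix.one_apply_eq] at h0
    linarith
  · have h1 : ∑ i, (∑ k, S k i) * A i j = ∑ k, (S * A) k j := by
      simp only [Matrix.mul_apply, Finset.sum_mul]
      exact Finset.sum_comm
    rw [h1, hSA]
    have h2 : ∑ k, (1 : Matrix (Fin N) (Fin N) ℝ) k j = 1 := by simp [Matrix.one_apply]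
    simp only [Matrix.sub_apply, Matrix.add_apply, Finset.sum_sub_distrib,
      Finset.sum_add_distrib, h2]
    linarith [hcol j]

open scoped Matrix.Norms.Operator in
theorem matrixSpectralRadius_lt_one_of_rowSums {N : ℕ} {A : Matrix (Fin N) (Fin N) ℝ}
    (hA : ∀ i, ∑ j, |A i j| < 1) : matrixSpectralRadius A < 1 := by
  -- Index `0` is the first power: `ρ` is at most `‖A‖ * ‖1‖`. The case `N = 0` is split off because
  -- `‖1‖ = 1` needs a nonempty index type.
  have h := spectrum.spectralRadius_le_pow_nnnorm_pow_one_div ℂ (A.map (algebraMap ℝ ℂ)) 0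
  refine lt_of_le_of_lt h ?_
  rcases Nat.eq_zero_or_pos N with rfl | hN
  · simp [Subsingleton.elim _ (0 : Matrix (Fin 0) (Fin 0) ℂ)]
  have : Nonempty (Fin N) := ⟨⟨0, hN⟩⟩
  have h1 : ‖A.map (algebraMap ℝ ℂ)‖₊ < 1 := by
    rw [Matrix.linfty_opNNNorm_def, Finset.sup_lt_iff one_pos]
    intro i _
    rw [← NNReal.coe_lt_coe]
    simpa using hA i
  simpa using h1

/-! ### Spreading rates on and near the unit cube. -/

section SpreadingRates

variable {N : ℕ}

theorem isCompact_unitCube : IsCompact (unitCube N) := by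
  have : unitCube N = Icc 0 1 := by
    ext x
    simp [unitCube, Pi.le_def, forall_and]
  rw [this]
  exact isCompact_Icc

theorem zero_mem_unitCube : (0 : Fin N → ℝ) ∈ unitCube N := fun i => by simp

theorem smul_mem_unitCube {x : Fin N → ℝ} (hx : x ∈ unitCube N) {s : ℝ} (hs : s ∈ Icc (0 : ℝ) 1) :
    s • x ∈ unitCube N := fun i =>
  ⟨mul_nonneg hs.1 (hx i).1, mul_le_one₀ hs.2 (hx i).1 (hx i).2⟩

theorem fderiv_eq_sum_partialDeriv (f : (Fin N → ℝ) → ℝ) (x v : Fin N → ℝ) :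
    fderiv ℝ f x v = ∑ j, v j * partialDeriv f j x := by
  conv_lhs => rw [pi_eq_sum_univ' v]
  rw [map_sum]
  refine Finset.sum_congr rfl fun j _ => ?_
  rw [map_smul, smul_eq_mul, partialDeriv]

theorem hasDerivAt_comp_smul {f : (Fin N → ℝ) → ℝ} {x : Fin N → ℝ} {s : ℝ}
    (hf : DifferentiableAt ℝ f (s • x)) :
    HasDerivAt (fun r : ℝ => f (r • x)) (∑ j, x j * partialDeriv f j (s • x)) s := by
  rw [← fderiv_eq_sum_partialDeriv]
  have h : HasDerivAt (fun r : ℝ => r • x) x s := by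
    simpa using (hasDerivAt_id s).smul_const x
  exact hf.hasFDerivAt.comp_hasDerivAt s h

/-- A function that is `C¹` around every point of a compact set satisfies a Lipschitz estimate between
the points of the set and all points of a uniform neighbourhood. -/
theorem IsCompact.exists_uniform_lipschitz {E : Type*} [NormedAddCommGroup E] [NormedSpace ℝ E]
    {K : Set E} (hK : IsCompact K) {f : E → ℝ} (hf : ∀ x ∈ K, ContDiffAt ℝ 1 f x) :
    ∃ δ > 0, ∃ L ≥ 0, ∀ p ∈ K, ∀ y, dist y p < δ → |f y - f p| ≤ L * dist y p := by
  refine hK.induction_on (p := fun s => ∃ δ > 0, ∃ L ≥ 0, ∀ p ∈ s, ∀ y, dist y p < δ →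
    |f y - f p| ≤ L * dist y p) ⟨1, one_pos, 0, le_rfl, by simp⟩ ?_ ?_ ?_
  · rintro s t hst ⟨δ, hδ, L, hL, h⟩
    exact ⟨δ, hδ, L, hL, fun p hp => h p (hst hp)⟩
  · rintro s t ⟨δ, hδ, L, hL, h⟩ ⟨δ', hδ', L', hL', h'⟩
    refine ⟨min δ δ', lt_min hδ hδ', max L L', le_max_of_le_left hL, ?_⟩
    rintro p (hp | hp) y hy
    · exact (h p hp y (hy.trans_le (min_le_left _ _))).trans
        (mul_le_mul_of_nonneg_right (le_max_left _ _) dist_nonneg)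
    · exact (h' p hp y (hy.trans_le (min_le_right _ _))).trans
        (mul_le_mul_of_nonneg_right (le_max_right _ _) dist_nonneg)
  · intro x hx
    obtain ⟨L, t, ht, hL⟩ := (hf x hx).exists_lipschitzOnWith
    obtain ⟨r, hr, hrt⟩ := Metric.mem_nhds_iff.1 ht
    refine ⟨Metric.ball x (r / 2), mem_nhdsWithin_of_mem_nhds (Metric.ball_mem_nhds x (half_pos hr)),
      r / 2, half_pos hr, L, L.2, fun p hp y hy => ?_⟩
    rw [Metric.mem_ball] at hp
    have h1 : y ∈ t := hrt (by
      rw [Metric.mem_ball]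
      linarith [dist_triangle y p x])
    have h2 : p ∈ t := hrt (by rw [Metric.mem_ball]; linarith)
    simpa [Real.dist_eq] using hL.dist_le_mul y h1 p h2

namespace IsSpreadingRate

variable {E : Fin N → Fin N → Prop} {f : Fin N → (Fin N → ℝ) → ℝ}

theorem differentiableAt (hf : IsSpreadingRate E f) (i : Fin N) {x : Fin N → ℝ}
    (hx : x ∈ unitCube N) : DifferentiableAt ℝ (f i) x :=
  (hf.smooth i x hx).differentiableAt (by norm_num)

theorem differentiableAt_partialDeriv (hf : IsSpreadingRate E f) (i k : Fin N) {x : Fin N → ℝ}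
    (hx : x ∈ unitCube N) : DifferentiableAt ℝ (partialDeriv (f i) k) x := by
  have h : ContDiffAt ℝ 1 (fderiv ℝ (f i)) x :=
    (hf.smooth i x hx).fderiv_right (by norm_num)
  exact (h.differentiableAt (by norm_num)).clm_apply (differentiableAt_const _)

/-- Without dependence on `x_j`, the rate is constant on the unit segment through `x` in direction
`j`. Even if `x` is an endpoint, the derivative within that segment is unique, so the partial
derivative is 0. -/
theorem partialDeriv_nonneg (hf : IsSpreadingRate E f) (i j : Fin N) {x : Fin N → ℝ}
    (hx : x ∈ unitCube N) : 0 ≤ partialDeriv (f i) j x := by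
  by_cases hdep : DependsOnArg (f i) j
  · exact (hf.mono i j hdep x hx).le
  have hline : HasDerivAt (fun s : ℝ => x + s • (Pi.single j 1 : Fin N → ℝ))
      (Pi.single j 1) 0 := by
    simpa using ((hasDerivAt_id (0 : ℝ)).smul_const (Pi.single j 1 : Fin N → ℝ)).const_add x
  have hd : HasDerivAt (fun s : ℝ => f i (x + s • (Pi.single j 1 : Fin N → ℝ)))
      (partialDeriv (f i) j x) 0 := by
    refine HasFDerivAt.comp_hasDerivAt (0 : ℝ) ?_ hline
    simpa using (hf.differentiableAt i hx).hasFDerivAt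
  have hmem : (0 : ℝ) ∈ Icc (-x j) (1 - x j) := ⟨by linarith [(hx j).1], by linarith [(hx j).2]⟩
  have hconst : HasDerivWithinAt (fun s : ℝ => f i (x + s • (Pi.single j 1 : Fin N → ℝ))) 0
      (Icc (-x j) (1 - x j)) 0 := by
    refine (hasDerivWithinAt_const (0 : ℝ) _ (f i x)).congr_of_mem (fun s hs => ?_) hmem
    by_contra hne
    refine hdep ⟨_, fun k => ?_, x, hx, fun k hk => ?_, hne⟩
    · by_cases hk : k = j
      · subst hk
        simp only [Pi.add_apply, Pi.smul_apply, Pi.single_eq_same, smul_eq_mul, mul_one]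
        exact ⟨by linarith [hs.1], by linarith [hs.2]⟩
      · simpa [hk] using hx k
    · simp [hk]
  have huniq := uniqueDiffOn_Icc (show -x j < 1 - x j by linarith) 0 hmem
  exact (huniq.eq_deriv _ hconst hd.hasDerivWithinAt).le

theorem nonneg (hf : IsSpreadingRate E f) (i : Fin N) {x : Fin N → ℝ}
    (hx : x ∈ unitCube N) : 0 ≤ f i x := by
  have hd : ∀ s ∈ Icc (0 : ℝ) 1, HasDerivAt (fun r : ℝ => f i (r • x))
      (∑ j, x j * partialDeriv (f i) j (s • x)) s := fun s hs =>
    hasDerivAt_comp_smul (hf.differentiableAt i (smul_mem_unitCube hx hs))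
  have hmono : MonotoneOn (fun r : ℝ => f i (r • x)) (Icc 0 1) := by
    refine monotoneOn_of_deriv_nonneg (convex_Icc 0 1)
      (fun s hs => (hd s hs).continuousAt.continuousWithinAt)
      (fun s hs => (hd s (interior_subset hs)).differentiableAt.differentiableWithinAt)
      fun s hs => ?_
    rw [(hd s (interior_subset hs)).deriv]
    exact Finset.sum_nonneg fun j _ => mul_nonneg (hx j).1
      (hf.partialDeriv_nonneg i j (smul_mem_unitCube hx (interior_subset hs)))
  have := hmono (left_mem_Icc.2 zero_le_one) (right_mem_Icc.2 zero_le_one) zero_le_one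
  simpa [hf.nullity i] using this

/-- Concavity: a spreading rate lies below its linearization at the origin. -/
theorem le_linearization (hf : IsSpreadingRate E f) (i : Fin N) {x : Fin N → ℝ}
    (hx : x ∈ unitCube N) : f i x ≤ ∑ j, partialDeriv (f i) j 0 * x j := by
  have hd : ∀ s ∈ Icc (0 : ℝ) 1, HasDerivAt (fun r : ℝ => f i (r • x))
      (∑ j, x j * partialDeriv (f i) j (s • x)) s := fun s hs =>
    hasDerivAt_comp_smul (hf.differentiableAt i (smul_mem_unitCube hx hs))
  have hd2 : ∀ s ∈ Icc (0 : ℝ) 1,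
      HasDerivAt (fun r : ℝ => ∑ j, x j * partialDeriv (f i) j (r • x))
        (∑ j, x j * ∑ k, x k * partialDeriv (partialDeriv (f i) j) k (s • x)) s := fun s hs =>
    HasDerivAt.fun_sum fun j _ => (hasDerivAt_comp_smul
      (hf.differentiableAt_partialDeriv i j (smul_mem_unitCube hx hs))).const_mul (x j)
  have hanti : AntitoneOn (fun r : ℝ => ∑ j, x j * partialDeriv (f i) j (r • x)) (Icc 0 1) := by
    refine antitoneOn_of_deriv_nonpos (convex_Icc 0 1)
      (fun s hs => (hd2 s hs).continuousAt.continuousWithinAt)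
      (fun s hs => (hd2 s (interior_subset hs)).differentiableAt.differentiableWithinAt)
      fun s hs => ?_
    rw [(hd2 s (interior_subset hs)).deriv]
    exact Finset.sum_nonpos fun j _ => mul_nonpos_of_nonneg_of_nonpos (hx j).1 <|
      Finset.sum_nonpos fun k _ => mul_nonpos_of_nonneg_of_nonpos (hx k).1 <|
        hf.concave i k j _ (smul_mem_unitCube hx (interior_subset hs))
  have hle := (convex_Icc (0 : ℝ) 1).image_sub_le_mul_sub_of_deriv_le
    (f := fun r : ℝ => f i (r • x)) (C := ∑ j, x j * partialDeriv (f i) j 0)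
    (fun s hs => (hd s hs).continuousAt.continuousWithinAt)
    (fun s hs => (hd s (interior_subset hs)).differentiableAt.differentiableWithinAt)
    (fun s hs => by
      rw [(hd s (interior_subset hs)).deriv]
      have hs' := interior_subset hs
      simpa using hanti (left_mem_Icc.2 zero_le_one) hs' hs'.1)
    0 (left_mem_Icc.2 zero_le_one) 1 (right_mem_Icc.2 zero_le_one) zero_le_one
  simpa [hf.nullity i, mul_comm] using hle

/-- Slightly outside the unit cube, spreading rates are bounded and only slightly negative. -/
theorem eventually_bounds (hf : IsSpreadingRate E f) (i : Fin N) :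
    ∃ C ≥ 0, ∀ᶠ η in 𝓝[>] (0 : ℝ), ∀ x : Fin N → ℝ, (∀ j, -η ≤ x j ∧ x j ≤ 1 + 2 * η) →
      -C * η ≤ f i x ∧ f i x ≤ C := by
  obtain ⟨δ, hδ, L, hL, hlip⟩ := isCompact_unitCube.exists_uniform_lipschitz
    fun x hx => (hf.smooth i x hx).of_le (by norm_num)
  set S := ∑ j, partialDeriv (f i) j 0 with hS
  have hS0 : 0 ≤ S := Finset.sum_nonneg fun j _ => hf.partialDeriv_nonneg i j zero_mem_unitCube
  refine ⟨S + 2 * L, by positivity, ?_⟩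
  filter_upwards [Ioo_mem_nhdsGT (show 0 < min 1 (δ / 2) by positivity)] with η hη x hx
  have hη0 : 0 < η := hη.1
  have hη1 : η < 1 := hη.2.trans_le (min_le_left _ _)
  have hηδ : η < δ / 2 := hη.2.trans_le (min_le_right _ _)
  -- Clamping `x` to the cube moves it by at most `2 * η`; at `p` the rate lies in `[0, S]`, and the
  -- Lipschitz error is at most `2 * L * η`.
  set p : Fin N → ℝ := fun j => max 0 (min 1 (x j)) with hp
  have hpc : p ∈ unitCube N := fun j =>
    ⟨le_max_left _ _, max_le zero_le_one (min_le_left _ _)⟩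
  have hdist : dist x p ≤ 2 * η := by
    refine (dist_pi_le_iff (by positivity)).2 fun j => ?_
    rw [Real.dist_eq, abs_le]
    simp only [hp]
    rcases hx j with ⟨h1, h2⟩
    rcases max_cases 0 (min 1 (x j)) with h | h <;> rcases min_cases 1 (x j) with h' | h' <;>
      constructor <;> linarith
  have habs := abs_le.1 ((hlip p hpc x (by linarith)).trans
    (mul_le_mul_of_nonneg_left hdist hL))
  have hfp0 := hf.nonneg i hpc
  have hfpS : f i p ≤ S := (hf.le_linearization i hpc).trans <|
    Finset.sum_le_sum fun j _ => mul_le_of_le_one_right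
      (hf.partialDeriv_nonneg i j zero_mem_unitCube) (hpc j).2
  have hSη : 0 ≤ S * η := by positivity
  have hLη : L * η ≤ L := mul_le_of_le_one_right hL hη1.le
  exact ⟨by linarith, by linarith⟩

end IsSpreadingRate

end SpreadingRates

/-! ### Invariance of the state space and attraction. -/

/-- The product is negative only when the factors have opposite signs; then one is of order `η` and
the other bounded. The 3 bounds the state coordinates, which stay below `1 + 2 * η` with `η < 1`. -/
theorem neg_mul_le_mul_of_mem {C η u y : ℝ} (hC : 0 ≤ C) (hη : 0 ≤ η)
    (hu : -η ≤ u) (hu' : u ≤ 3) (hy : -C * η ≤ y) (hy' : y ≤ C) : -(3 * C * η) ≤ u * y := by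
  have hCη : 0 ≤ C * η := mul_nonneg hC hη
  rcases le_total 0 u with h | h <;> rcases le_total 0 y with h' | h'
  · have := mul_nonneg h h'
    linarith
  · have := mul_le_mul_of_nonneg_left hy h
    have := mul_le_mul_of_nonneg_right hu' hCη
    linarith
  · have h1 := mul_le_mul_of_nonneg_right hu h'
    have h2 := mul_le_mul_of_nonneg_left hy' hη
    linarith
  · have := mul_nonneg_of_nonpos_of_nonpos h h'
    linarith

namespace URTUModel

variable {N : ℕ}

/-- The state space is positively invariant. -/
theorem IsSolution.mem_stateSpace {M : URTUModel N} {z : ℝ → (Fin N → ℝ) × (Fin N → ℝ)}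
    (hz : M.IsSolution z) (h0 : z 0 ∈ stateSpace N) : ∀ t, 0 ≤ t → z t ∈ stateSpace N := by
  -- Membership in `Ω` is nonnegativity of `R_i`, `T_i` and the uncertain share `1 - R_i - T_i`. In
  -- the derivative of the last, the exchange terms between `R` and `T` cancel.
  let u : Fin N ⊕ Fin N ⊕ Fin N → ℝ → ℝ := Sum.elim (fun i t => (z t).1 i)
    (Sum.elim (fun i t => (z t).2 i) fun i t => 1 - (z t).1 i - (z t).2 i)
  let dR : Fin N → ℝ → ℝ := fun i t =>
    (1 - (z t).1 i - (z t).2 i) * M.fU i (z t).1 - M.deltaR i * (z t).1 i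
      + (z t).2 i * M.fT i (z t).1 - (z t).1 i * M.gR i (z t).2
  let dT : Fin N → ℝ → ℝ := fun i t =>
    (1 - (z t).1 i - (z t).2 i) * M.gU i (z t).2 - M.deltaT i * (z t).2 i
      + (z t).1 i * M.gR i (z t).2 - (z t).2 i * M.fT i (z t).1
  let u' : Fin N ⊕ Fin N ⊕ Fin N → ℝ → ℝ :=
    Sum.elim dR (Sum.elim dT fun i t => -dR i t - dT i t)
  have hd : ∀ a t, 0 ≤ t → HasDerivWithinAt (u a) (u' a t) (Ici 0) t := by
    rintro (i | i | i) t ht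
    · exact (hz t ht i).1
    · exact (hz t ht i).2
    · have h := (((hz t ht i).1).const_sub 1).sub (hz t ht i).2
      exact h
  have hbox : ∀ η > 0, ∀ t, (∀ b, -η ≤ u b t) → ∀ i, -η ≤ (z t).1 i ∧ -η ≤ (z t).2 i ∧
      -η ≤ 1 - (z t).1 i - (z t).2 i := fun η _ t h i =>
    ⟨h (.inl i), h (.inr (.inl i)), h (.inr (.inr i))⟩
  have hq : ∀ a, ∃ C, ∀ᶠ η in 𝓝[>] (0 : ℝ), ∀ t, 0 ≤ t → (∀ b, -η ≤ u b t) → u a t = -η →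
      -C * η ≤ u' a t := by
    have main : ∀ i, ∃ C, ∀ᶠ η in 𝓝[>] (0 : ℝ), ∀ t, 0 ≤ t → (∀ b, -η ≤ u b t) →
        ((z t).1 i = -η → -C * η ≤ dR i t) ∧ ((z t).2 i = -η → -C * η ≤ dT i t) ∧
        (1 - (z t).1 i - (z t).2 i = -η → -C * η ≤ -dR i t - dT i t) := by
      intro i
      obtain ⟨C₁, hC₁, h₁⟩ := M.fU_rate.eventually_bounds i
      obtain ⟨C₂, hC₂, h₂⟩ := M.fT_rate.eventually_bounds i
      obtain ⟨C₃, hC₃, h₃⟩ := M.gU_rate.eventually_bounds i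
      obtain ⟨C₄, hC₄, h₄⟩ := M.gR_rate.eventually_bounds i
      have hδR := M.deltaR_pos i
      have hδT := M.deltaT_pos i
      refine ⟨3 * (C₁ + C₂ + C₃ + C₄) + M.deltaR i + M.deltaT i, ?_⟩
      filter_upwards [h₁, h₂, h₃, h₄, Ioo_mem_nhdsGT one_pos] with η h₁ h₂ h₃ h₄ hη t _ hb
      have hη0 : 0 < η := hη.1
      have hη1 : η < 1 := hη.2
      have hbx := hbox η hη0 t hb
      have hR : ∀ j, -η ≤ (z t).1 j ∧ (z t).1 j ≤ 1 + 2 * η := fun j =>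
        ⟨(hbx j).1, by linarith [(hbx j).2.1, (hbx j).2.2]⟩
      have hT : ∀ j, -η ≤ (z t).2 j ∧ (z t).2 j ≤ 1 + 2 * η := fun j =>
        ⟨(hbx j).2.1, by linarith [(hbx j).1, (hbx j).2.2]⟩
      obtain ⟨l₁, r₁⟩ := h₁ _ hR
      obtain ⟨l₂, r₂⟩ := h₂ _ hR
      obtain ⟨l₃, r₃⟩ := h₃ _ hT
      obtain ⟨l₄, r₄⟩ := h₄ _ hT
      obtain ⟨bR, bR'⟩ := hR i
      obtain ⟨bT, bT'⟩ := hT i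
      have bU := (hbx i).2.2
      simp only [dR, dT]
      have e₁ := neg_mul_le_mul_of_mem hC₁ hη0.le bU (by linarith) l₁ r₁
      have e₂ := neg_mul_le_mul_of_mem hC₂ hη0.le bT (by linarith) l₂ r₂
      have e₃ := neg_mul_le_mul_of_mem hC₃ hη0.le bU (by linarith) l₃ r₃
      have e₄ := neg_mul_le_mul_of_mem hC₄ hη0.le bR (by linarith) l₄ r₄
      -- These bound `η` times a rate, the form an outflow term takes when its own coordinate equals
      -- `-η`.
      have s₁ := neg_mul_le_mul_of_mem hC₁ hη0.le (by linarith : -η ≤ η)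
        (by linarith) l₁ r₁
      have s₂ := neg_mul_le_mul_of_mem hC₂ hη0.le (by linarith : -η ≤ η)
        (by linarith) l₂ r₂
      have s₃ := neg_mul_le_mul_of_mem hC₃ hη0.le (by linarith : -η ≤ η)
        (by linarith) l₃ r₃
      have s₄ := neg_mul_le_mul_of_mem hC₄ hη0.le (by linarith : -η ≤ η)
        (by linarith) l₄ r₄
      have p₁ := mul_nonneg hC₁ hη0.le
      have p₂ := mul_nonneg hC₂ hη0.le
      have p₃ := mul_nonneg hC₃ hη0.le
      have p₄ := mul_nonneg hC₄ hη0.le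
      have pR := mul_nonneg hδR.le hη0.le
      have pT := mul_nonneg hδT.le hη0.le
      refine ⟨fun h => ?_, fun h => ?_, fun h => ?_⟩
      · have k₁ : M.deltaR i * (z t).1 i = -(M.deltaR i * η) := by rw [h]; ring
        have k₂ : (z t).1 i * M.gR i (z t).2 = -(η * M.gR i (z t).2) := by rw [h]; ring
        linarith
      · have k₁ : M.deltaT i * (z t).2 i = -(M.deltaT i * η) := by rw [h]; ring
        have k₂ : (z t).2 i * M.fT i (z t).1 = -(η * M.fT i (z t).1) := by rw [h]; ring
        linarith
      · have k₁ : (1 - (z t).1 i - (z t).2 i) * M.fU i (z t).1 = -(η * M.fU i (z t).1) := by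
          rw [h]; ring
        have k₂ : (1 - (z t).1 i - (z t).2 i) * M.gU i (z t).2 = -(η * M.gU i (z t).2) := by
          rw [h]; ring
        have k₃ := mul_le_mul_of_nonneg_left bR hδR.le
        have k₄ := mul_le_mul_of_nonneg_left bT hδT.le
        linarith
    rintro (i | i | i) <;> obtain ⟨C, hC⟩ := main i <;> refine ⟨C, hC.mono fun η h t ht hb => ?_⟩
    · exact (h t ht hb).1
    · exact (h t ht hb).2.1
    · exact (h t ht hb).2.2
  have hu0 : ∀ a, 0 ≤ u a 0 := by
    rintro (i | i | i)
    · exact (h0 i).1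
    · exact (h0 i).2.1
    · have := (h0 i).2.2
      simp only [u, Sum.elim_inr]
      linarith
  intro t ht i
  have h := nonneg_of_quasipositive hd hu0 hq t ht
  have h3 := h (.inr (.inr i))
  simp only [u, Sum.elim_inr] at h3
  exact ⟨h (.inl i), h (.inr (.inl i)), by linarith⟩

theorem mem_unitCube_of_mem_stateSpace {z : (Fin N → ℝ) × (Fin N → ℝ)} (hz : z ∈ stateSpace N) :
    z.1 ∈ unitCube N ∧ z.2 ∈ unitCube N :=
  ⟨fun i => ⟨(hz i).1, by linarith [(hz i).2.1, (hz i).2.2]⟩,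
    fun i => ⟨(hz i).2.1, by linarith [(hz i).1, (hz i).2.2]⟩⟩

/-- `E_U` attracts the state space as soon as `f_U` and `g_U` lie below linear maps `A`, `B` that
admit positive weights `v`, `w` with `v A < v D_R` and `w B < w D_T`. -/
theorem attracts_of_weights (M : URTUModel N) {A B : Matrix (Fin N) (Fin N) ℝ}
    (hfA : ∀ i, ∀ x ∈ unitCube N, M.fU i x ≤ ∑ j, A i j * x j)
    (hgB : ∀ i, ∀ x ∈ unitCube N, M.gU i x ≤ ∑ j, B i j * x j)
    (hA : ∃ v : Fin N → ℝ, (∀ i, 0 < v i) ∧ ∀ j, ∑ i, v i * A i j < v j * M.deltaR j)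
    (hB : ∃ w : Fin N → ℝ, (∀ i, 0 < w i) ∧ ∀ j, ∑ i, w i * B i j < w j * M.deltaT j) :
    M.Attracts (uncertainEquilibrium N) (stateSpace N) := by
  intro z hz h0
  obtain ⟨v, hv, hvA⟩ := hA
  obtain ⟨w, hw, hwB⟩ := hB
  have hinv := hz.mem_stateSpace h0
  refine Tendsto.prodMk_nhds (mx := fun t => (z t).1) (my := fun t => (z t).2) ?_ ?_
  · refine tendsto_zero_of_weights hv hvA (fun t ht i => (hinv t ht i).1)
      (fun t ht i => (hz t ht i).1) fun t ht i => ?_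
    obtain ⟨hR, hT⟩ := mem_unitCube_of_mem_stateSpace (hinv t ht)
    -- `h1` replaces `T f_T` by `T f_U`; `h2` and `h3` discard `-R f_U` and `-R g_R`.
    have h1 := mul_le_mul_of_nonneg_left (M.ordering_f i _ hR) (hT i).1
    have h2 := mul_nonneg (hR i).1 (M.fU_rate.nonneg i hR)
    have h3 := mul_nonneg (hR i).1 (M.gR_rate.nonneg i hT)
    linarith [hfA i _ hR]
  · refine tendsto_zero_of_weights hw hwB (fun t ht i => (hinv t ht i).2.1)
      (fun t ht i => (hz t ht i).2) fun t ht i => ?_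
    obtain ⟨hR, hT⟩ := mem_unitCube_of_mem_stateSpace (hinv t ht)
    have h1 := mul_le_mul_of_nonneg_left (M.ordering_g i _ hT) (hR i).1
    have h2 := mul_nonneg (hT i).1 (M.gU_rate.nonneg i hT)
    have h3 := mul_nonneg (hT i).1 (M.fT_rate.nonneg i hR)
    linarith [hgB i _ hT]

/-! ### Scaling by the recovery rates and the four conditions. -/

theorem diagonal_mul_inv_of_pos {d : Fin N → ℝ} (hd : ∀ i, 0 < d i) :
    Matrix.diagonal d * (Matrix.diagonal d)⁻¹ = 1 := by
  refine Matrix.mul_nonsing_inv _ ?_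
  rw [Matrix.det_diagonal]
  exact (Finset.prod_ne_zero_iff.2 fun i _ => (hd i).ne').isUnit

theorem mul_diagonal_inv_apply {d : Fin N → ℝ} (hd : ∀ i, 0 < d i)
    (A : Matrix (Fin N) (Fin N) ℝ) (i j : Fin N) :
    (A * (Matrix.diagonal d)⁻¹) i j = A i j / d j := by
  have h : (Matrix.diagonal d)⁻¹ = Matrix.diagonal fun i => (d i)⁻¹ := by
    refine Matrix.inv_eq_right_inv ?_
    rw [Matrix.diagonal_mul_diagonal, ← Matrix.diagonal_one]
    congr 1
    funext i
    exact mul_inv_cancel₀ (hd i).ne'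
  rw [h, Matrix.mul_diagonal, div_eq_mul_inv]

theorem exists_weights_of_spectralRadius_mul_inv_lt_one {d : Fin N → ℝ} (hd : ∀ i, 0 < d i)
    {A : Matrix (Fin N) (Fin N) ℝ} (hA : ∀ i j, 0 ≤ A i j)
    (hρ : matrixSpectralRadius (A * (Matrix.diagonal d)⁻¹) < 1) :
    ∃ w : Fin N → ℝ, (∀ i, 0 < w i) ∧ ∀ j, ∑ i, w i * A i j < w j * d j := by
  obtain ⟨w, hw, h⟩ := exists_weights_of_spectralRadius_lt_one
    (fun i j => by
      rw [mul_diagonal_inv_apply hd]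
      exact div_nonneg (hA i j) (hd j).le) hρ
  refine ⟨w, hw, fun j => ?_⟩
  have hj := h j
  simp only [mul_diagonal_inv_apply hd, ← mul_div_assoc, ← Finset.sum_div] at hj
  exact (div_lt_iff₀ (hd j)).1 hj

theorem spectralRadius_mul_inv_lt_one_of_rowSums {d : Fin N → ℝ} (hd : ∀ i, 0 < d i)
    {A : Matrix (Fin N) (Fin N) ℝ} (hA : ∀ i j, 0 ≤ A i j) (h : ∀ i, ∑ j, A i j / d j < 1) :
    matrixSpectralRadius (A * (Matrix.diagonal d)⁻¹) < 1 := by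
  refine matrixSpectralRadius_lt_one_of_rowSums fun i => ?_
  simpa only [mul_diagonal_inv_apply hd, abs_of_nonneg (div_nonneg (hA i _) (hd _).le)] using h i

end URTUModel

theorem corollary1 {N : ℕ} (M : URTUModel N) :
    ((matrixSpectralRadius (M.Q1 * M.DR⁻¹ + 1) < 1 ∧
        matrixSpectralRadius (M.Q2 * M.DT⁻¹ + 1) < 1) →
      M.Attracts (uncertainEquilibrium N) (stateSpace N)) ∧
    (M.PairwiseRates →
      ((matrixSpectralRadius (M.BU * M.DR⁻¹) < 1 ∧ matrixSpectralRadius (M.CU * M.DT⁻¹) < 1) ∨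
        (∀ j, ∑ i, M.BU i j < M.deltaR j ∧ ∑ i, M.CU i j < M.deltaT j) ∨
        (∀ i, ∑ j, M.BU i j / M.deltaR j < 1 ∧ ∑ j, M.CU i j / M.deltaT j < 1)) →
      M.Attracts (uncertainEquilibrium N) (stateSpace N)) := by
  open URTUModel in
  refine ⟨fun ⟨hR, hT⟩ => ?_, fun hP h => ?_⟩
  · rw [Q1, sub_mul, DR, diagonal_mul_inv_of_pos M.deltaR_pos, sub_add_cancel] at hR
    rw [Q2, sub_mul, DT, diagonal_mul_inv_of_pos M.deltaT_pos, sub_add_cancel] at hT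
    exact M.attracts_of_weights (fun i x hx => M.fU_rate.le_linearization i hx)
      (fun i x hx => M.gU_rate.le_linearization i hx)
      (exists_weights_of_spectralRadius_mul_inv_lt_one M.deltaR_pos
        (fun i j => M.fU_rate.partialDeriv_nonneg i j zero_mem_unitCube) hR)
      (exists_weights_of_spectralRadius_mul_inv_lt_one M.deltaT_pos
        (fun i j => M.gU_rate.partialDeriv_nonneg i j zero_mem_unitCube) hT)
  · refine M.attracts_of_weights hP.1 hP.2 ?_ ?_
    · rcases h with h | h | h
      · exact exists_weights_of_spectralRadius_mul_inv_lt_one M.deltaR_pos M.BU_nonneg h.1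
      · exact ⟨fun _ => 1, fun _ => one_pos, fun j => by simpa using (h j).1⟩
      · exact exists_weights_of_spectralRadius_mul_inv_lt_one M.deltaR_pos M.BU_nonneg
          (spectralRadius_mul_inv_lt_one_of_rowSums M.deltaR_pos M.BU_nonneg fun i => (h i).1)
    · rcases h with h | h | h
      · exact exists_weights_of_spectralRadius_mul_inv_lt_one M.deltaT_pos M.CU_nonneg h.2
      · exact ⟨fun _ => 1, fun _ => one_pos, fun j => by simpa using (h j).2⟩
      · exact exists_weights_of_spectralRadius_mul_inv_lt_one M.deltaT_pos M.CU_nonneg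
          (spectralRadius_mul_inv_lt_one_of_rowSums M.deltaT_pos M.CU_nonneg fun i => (h i).2)
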